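/- Let $d\ge 3$ and let $\mathbb T_d$ be the infinite tree in which every vertex has exactly $d$ neighbours. For $\epsilon\in(0,1)$, the noisy majority vote process on $\mathbb T_d$ with noise $\epsilon$ is the discrete-time Markov chain on $\{-1,1\}^{\mathbb T_d}$ (with the product $\sigma$-algebra) in which, at each time step $t\ge 1$, all vertices are updated simultaneously and, given the configuration $\sigma(t-1)$, independently of each other: with probability $1-\epsilon$ a vertex $x$ takes the majority of the spins of its $d$ neighbours at time $t-1$ (and keeps its own spin $\sigma_x(t-1)$ in case of a tie), and with probability $\epsilon$ it takes a spin chosen uniformly from $\{-1,1\}$. An equilibrium measure is a probability measure on $\{-1,1\}^{\mathbb T_d}$ that is invariant under this chain. For every $d\ge 3$ there is $\epsilon_0=\epsilon_0(d)>0$ such that, for every $\epsilon\in(0,1)$ with $\epsilon<\epsilon_0$, the noisy majority vote process on $\mathbb T_d$ with noise $\epsilon$ is not ergodic: it has at least two distinct equilibrium measures. -/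

import Mathlib

namespace NoisyMajority

open MeasureTheory ProbabilityTheory

/-- A spin configuration: every vertex carries a spin in `{-1, 1}`. -/
abbrev Config (V : Type*) : Type _ := V → ℤˣ

/-- The randomness used at one vertex in one time step. The first coordinate tells whether a noise
event (`true`) or a vote event (`false`) occurs, the second one is the spin that is installed
in case of a noise event. -/
abbrev SiteInput : Type := Bool × ℤˣ

variable {V : Type*}

/-- The result of the vote at `x` when the current configuration is `σ`: the majority spin among
the neighbours of `x`, and the current spin of `x` in case of a tie. -/
def vote (G : SimpleGraph V) [G.LocallyFinite] (σ : Config V) (x : V) : ℤˣ :=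
  if 0 < ∑ y ∈ G.neighborFinset x, (σ y : ℤ) then 1
  else if ∑ y ∈ G.neighborFinset x, (σ y : ℤ) < 0 then -1
  else σ x

/-- One synchronous update of all the spins, given the random inputs `u` of all the vertices. -/
def step (G : SimpleGraph V) [G.LocallyFinite] (σ : Config V) (u : V → SiteInput) : Config V :=
  fun x => if (u x).1 = true then (u x).2 else vote G σ x

/-- The law of the input at one vertex: a noise event has probability `ε`, and the noise spin is
`1` or `-1` with probability `1 / 2` each, independently of the type of the event. -/
noncomputable def siteLaw (ε : unitInterval) : Measure SiteInput :=
  (bernoulliMeasure true false ε).prod (PMF.uniformOfFintype ℤˣ).toMeasure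

/-- The law of the inputs of all the vertices in one time step: independent over the vertices. -/
noncomputable def inputLaw (V : Type*) (ε : unitInterval) : Measure (V → SiteInput) :=
  Measure.infinitePi fun _ : V => siteLaw ε

instance (ε : unitInterval) : IsProbabilityMeasure (siteLaw ε) := by
  unfold siteLaw; infer_instance

instance (ε : unitInterval) : IsProbabilityMeasure (inputLaw V ε) := by
  unfold inputLaw; infer_instance

theorem measurable_vote (G : SimpleGraph V) [G.LocallyFinite] (x : V) :
    Measurable fun σ : Config V => vote G σ x := by
  have hval : Measurable (Units.val : ℤˣ → ℤ) := comap_measurable _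
  have hS : Measurable fun σ : Config V => ∑ y ∈ G.neighborFinset x, (σ y : ℤ) :=
    Finset.measurable_sum _ fun y _ => hval.comp (measurable_pi_apply y)
  unfold vote
  exact Measurable.ite (measurableSet_lt measurable_const hS) measurable_const
    (Measurable.ite (measurableSet_lt hS measurable_const) measurable_const
      (measurable_pi_apply x))

theorem measurable_step (G : SimpleGraph V) [G.LocallyFinite] :
    Measurable fun p : Config V × (V → SiteInput) => step G p.1 p.2 := by
  refine measurable_pi_lambda _ fun x => ?_
  have hu : Measurable fun p : Config V × (V → SiteInput) => p.2 x :=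
    (measurable_pi_apply x).comp measurable_snd
  unfold step
  exact Measurable.ite (hu.fst (measurableSet_singleton true)) hu.snd
    ((measurable_vote G x).comp measurable_fst)

/-- The transition kernel of the noisy majority vote process on `G` with noise `ε`, a
discrete-time Markov chain on `Config V`: `transition G ε σ` is the law of the configuration at
time `t`, given that the configuration at time `t - 1` is `σ`. -/
noncomputable def transition (G : SimpleGraph V) [G.LocallyFinite] (ε : unitInterval) :
    Kernel (Config V) (Config V) where
  toFun σ := (inputLaw V ε).map (step G σ)
  measurable' := by
    refine Measure.measurable_of_measurable_coe _ fun s hs => ?_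
    have hσ : ∀ σ : Config V, Measurable (step G σ) := fun σ =>
      (measurable_step G).comp (measurable_const.prodMk measurable_id)
    simp_rw [fun σ => Measure.map_apply (μ := inputLaw V ε) (hσ σ) hs]
    exact measurable_measure_prodMk_left (measurable_step G hs)

/-- An equilibrium measure of the noisy majority vote process: a probability measure on the
configurations which is invariant under the dynamics. -/
def IsEquilibrium (G : SimpleGraph V) [G.LocallyFinite] (ε : unitInterval)
    (μ : Measure (Config V)) : Prop :=
  IsProbabilityMeasure μ ∧ Kernel.Invariant (transition G ε) μ

end NoisyMajority

/-!
Small noise does not destroy the phase of mostly positive spins, and by the spin flip symmetry the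
phase of mostly negative spins survives as well. The positive phase is constructed by coupling from
the past: if all spins are `1` at a time `-k`, then the present configuration is monotone in `k`,
and its limit as `k → ∞` has an invariant law (`isEquilibrium_upperLaw`). It remains to show that
this law gives probability at most `1 / 3` to the spin `-1` at a vertex
(`noiseLaw_limitHistory_le`), since the flipped law then differs from it.

As `d ≥ 3`, a vote that results in `-1` needs two neighbours with spin `-1`. Write a site as
`(v, j)`, where `j` counts the time steps before the present. The sites with spin `-1` then lie in the
closure `M` of the set of noisy sites under the rule that a vertex with two neighbours in
`M (j + 1)` belongs to `M j`. The Peierls estimate is `exists_tour_of_path`: below a site of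
`M 0` there is a tour in the graph of sites which collects at least a fifth of its length in
distinct noisy sites. There are at most `(2 * d + 2) ^ (5 * n)` tours of length `5 * n`, and `n`
given sites are all noisy with probability `ε ^ n`, so the union bound gives a geometric series.

The tour is the boundary of a space-time region, found as follows. Consider a path of the tree such
that every second vertex, including the ends, lies in `M j`. If all the other vertices lie in
`M (j + 1)`, then one passes to the level `j + 1`, where each end of the path is either noisy and
removed, or prolonged by one vertex: the path grows except at the cost of noise. If some vertex `m`
of the path is not in `M (j + 1)`, the path is cut at `m`. The two parts do not share noisy sites
further below. Indeed, two sites of `M (j + 1)` above a common site are linked by a chain in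
`M (j + 1)` (`Descends.linked`), because by the closure rule linked components never split as one
moves up; but in a tree such a chain cannot get around `m`. Hence the length of the path serves as
a potential, bounded by the amount of noise collected, and the length of the tour is
proportional to it.
-/

namespace NoisyMajority

/-! ### Descent and linkage in a threshold-two closure -/

section Deterministic

variable {V : Type*} {G : SimpleGraph V}

/-- `Linked G A p q`: the vertices `p` and `q` are joined by a chain of elements of `A` in which
consecutive elements have a common neighbour. -/
def Linked (G : SimpleGraph V) (A : Set V) : V → V → Prop :=
  Relation.ReflTransGen fun p q => p ∈ A ∧ q ∈ A ∧ ∃ e, G.Adj p e ∧ G.Adj e q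

/-- `Descends G M p i a j`: the site `(p, i)` is reached from the site `(a, j)` by a walk that goes
one level down in each step and stays in the slices `M` after its start. -/
inductive Descends (G : SimpleGraph V) (M : ℕ → Set V) (p : V) (i : ℕ) : V → ℕ → Prop
  | refl : Descends G M p i p i
  | step {a q : V} {j : ℕ} : G.Adj a q → q ∈ M (j + 1) → Descends G M p i q (j + 1) →
      Descends G M p i a j

/-- `IsClosed₂ G M`: a vertex with two neighbours in the slice `M (j + 1)` lies in `M j`. -/
def IsClosed₂ (G : SimpleGraph V) (M : ℕ → Set V) : Prop :=
  ∀ ⦃j x y z⦄, G.Adj x y → G.Adj x z → y ≠ z → y ∈ M (j + 1) → z ∈ M (j + 1) → x ∈ M j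

/-- Every element of `M j` is in the source `N j` or has two neighbours in `M (j + 1)`. -/
def IsGenerated₂ (G : SimpleGraph V) (M N : ℕ → Set V) : Prop :=
  ∀ ⦃j x⦄, x ∈ M j → x ∈ N j ∨
    ∃ y z, y ≠ z ∧ G.Adj x y ∧ G.Adj x z ∧ y ∈ M (j + 1) ∧ z ∈ M (j + 1)

theorem Linked.of_adj {M : ℕ → Set V} (hM : IsClosed₂ G M) {j : ℕ} {q q' a b : V}
    (h : Linked G (M (j + 1)) q q') (ha : G.Adj a q) (hb : G.Adj b q') (haM : a ∈ M j)
    (hbM : b ∈ M j) : Linked G (M j) a b := by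
  induction h using Relation.ReflTransGen.head_induction_on generalizing a with
  | refl => exact .single ⟨haM, hbM, q', ha, hb.symm⟩
  | @head p r hpr _ ih =>
    obtain ⟨hp, hr, e, hpe, her⟩ := hpr
    rcases eq_or_ne p r with rfl | hne
    · exact ih ha haM
    · have he : e ∈ M j := hM hpe.symm her hne hp hr
      exact .head ⟨haM, he, p, ha, hpe⟩ (ih her he)

theorem Descends.le {M : ℕ → Set V} {p a : V} {i j : ℕ} (h : Descends G M p i a j) : j ≤ i := by
  induction h <;> omega

theorem Descends.eq_of_same_level {M : ℕ → Set V} {p a : V} {i : ℕ}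
    (h : Descends G M p i a i) : a = p := by
  cases h with
  | refl => rfl
  | step _ _ h => have := h.le; omega

/-- Seen from below, linked components never split: two sites above a common site are linked. -/
theorem Descends.linked {M : ℕ → Set V} (hM : IsClosed₂ G M) {p a b : V} {i j : ℕ}
    (h : Descends G M p i a j) (h' : Descends G M p i b j) (ha : a ∈ M j) (hb : b ∈ M j) :
    Linked G (M j) a b := by
  induction h generalizing b with
  | refl => rw [h'.eq_of_same_level]; exact .refl
  | step hadj hq hd ih =>
    cases h' with
    | refl => have := hd.le; omega
    | step hadj' hq' hd' => exact (ih hd' hq hq').of_adj hM hadj hadj' ha hb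

/-- In a forest, every walk between two neighbours of `m` passes through `m`. -/
theorem mem_support_of_adj_adj (hG : G.IsAcyclic) {x m y : V} (hx : G.Adj x m) (hy : G.Adj m y)
    (hxy : x ≠ y) (w : G.Walk x y) : m ∈ w.support := by
  have hb := SimpleGraph.isBridge_iff_forall_walk_mem_edges.1
    (SimpleGraph.isAcyclic_iff_forall_adj_isBridge.1 hG hx) (w.concat hy.symm)
  rw [SimpleGraph.Walk.edges_concat, List.concat_eq_append, List.mem_append,
    List.mem_singleton] at hb
  rcases hb with hb | hb
  · exact w.snd_mem_support_of_mem_edges hb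
  · rcases Sym2.eq_iff.1 hb with ⟨h, _⟩ | ⟨h, h'⟩
    · exact absurd h hxy
    · exact absurd h hx.ne

theorem Linked.exists_walk {A : Set V} {col : V → Bool}
    (hcol : ∀ ⦃u v⦄, G.Adj u v → col v = !col u) {m q q' : V} (h : Linked G A q q')
    (hq : q ∈ A) (hm : m ∉ A) (hc : col m = col q) : ∃ w : G.Walk q q', m ∉ w.support := by
  induction h using Relation.ReflTransGen.head_induction_on with
  | refl => exact ⟨.nil, by simpa using fun h : m = q' => hm (h ▸ hq)⟩
  | @head p r hpr _ ih =>
    obtain ⟨hp, hr, e, hpe, her⟩ := hpr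
    obtain ⟨w, hw⟩ := ih hr (by rw [hc, hcol her, hcol hpe, Bool.not_not])
    refine ⟨.cons hpe (.cons her w), ?_⟩
    have h1 : m ≠ p := fun h => hm (h ▸ hp)
    -- the intermediate vertices of the chain have the other colour
    have h2 : m ≠ e := by rintro rfl; rw [hcol hpe] at hc; simp at hc
    simp [h1, h2, hw]

/-! ### Tours -/

/-- `Tour G p q ℓ Z`: in `ℓ` moves one can go from the site `p` to the site `q` of `V × ℕ` and
collect the set `Z` of sites. A move goes to a neighbouring vertex one level up or down, or
collects the present site, or does nothing. -/
inductive Tour [DecidableEq V] (G : SimpleGraph V) :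
    V × ℕ → V × ℕ → ℕ → Finset (V × ℕ) → Prop
  | nil (p : V × ℕ) : Tour G p p 0 ∅
  | down {v w : V} {j : ℕ} {q : V × ℕ} {l : ℕ} {Z : Finset (V × ℕ)} :
      G.Adj v w → Tour G (w, j + 1) q l Z → Tour G (v, j) q (l + 1) Z
  | up {v w : V} {j : ℕ} {q : V × ℕ} {l : ℕ} {Z : Finset (V × ℕ)} :
      G.Adj v w → Tour G (w, j) q l Z → Tour G (v, j + 1) q (l + 1) Z
  | collect {p q : V × ℕ} {l : ℕ} {Z : Finset (V × ℕ)} :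
      Tour G p q l Z → Tour G p q (l + 1) (insert p Z)
  | wait {p q : V × ℕ} {l : ℕ} {Z : Finset (V × ℕ)} :
      Tour G p q l Z → Tour G p q (l + 1) Z

variable [DecidableEq V]

theorem Tour.trans {p q r : V × ℕ} {l l' : ℕ} {Z Z' : Finset (V × ℕ)} (h : Tour G p q l Z)
    (h' : Tour G q r l' Z') : Tour G p r (l + l') (Z ∪ Z') := by
  induction h with
  | nil p => simpa using h'
  | down ha _ ih => rw [Nat.add_right_comm]; exact .down ha (ih h')
  | up ha _ ih => rw [Nat.add_right_comm]; exact .up ha (ih h')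
  | collect _ ih => rw [Nat.add_right_comm, Finset.insert_union]; exact .collect (ih h')
  | wait _ ih => rw [Nat.add_right_comm]; exact .wait (ih h')

theorem Tour.of_le {p q : V × ℕ} {l l' : ℕ} {Z : Finset (V × ℕ)} (h : Tour G p q l Z)
    (hl : l ≤ l') : Tour G p q l' Z := by
  induction hl with
  | refl => exact h
  | step _ ih => exact .wait ih

theorem Tour.of_subset_singleton {p : V × ℕ} {Z : Finset (V × ℕ)} (hZ : Z ⊆ {p}) :
    Tour G p p Z.card Z := by
  rcases Finset.subset_singleton_iff.1 hZ with rfl | rfl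
  · exact .nil p
  · exact .collect (.nil p)

/-- The sets collected by the tours of a given length and starting point are at most exponentially
many. -/
theorem Tour.exists_finset [G.LocallyFinite] {d : ℕ} (hd : G.IsRegularOfDegree d) (l : ℕ)
    (p : V × ℕ) : ∃ F : Finset (Finset (V × ℕ)), F.card ≤ (2 * d + 2) ^ l ∧
      ∀ q Z, Tour G p q l Z → Z ∈ F := by
  induction l generalizing p with
  | zero =>
    refine ⟨{∅}, by simp, fun q Z h => ?_⟩
    cases h; simp
  | succ l ih =>
    choose F hF hmem using ih
    obtain ⟨v, j⟩ := p
    have hsum : ∀ i, ((G.neighborFinset v).biUnion fun w => F (w, i)).card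
        ≤ d * (2 * d + 2) ^ l := fun i =>
      (Finset.card_biUnion_le_card_mul _ _ _ fun w _ => hF (w, i)).trans_eq
        (by rw [G.card_neighborFinset_eq_degree, hd v])
    refine ⟨((G.neighborFinset v).biUnion fun w => F (w, j + 1)) ∪
      ((G.neighborFinset v).biUnion fun w => F (w, j - 1)) ∪
      ((F (v, j)).image (insert (v, j)) ∪ F (v, j)), ?_, fun q Z h => ?_⟩
    · refine (Finset.card_union_le _ _).trans ?_
      have h1 := (Finset.card_union_le ((G.neighborFinset v).biUnion fun w => F (w, j + 1))
        ((G.neighborFinset v).biUnion fun w => F (w, j - 1)))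
      have h2 := Finset.card_union_le ((F (v, j)).image (insert (v, j))) (F (v, j))
      have h3 := (Finset.card_image_le (s := F (v, j)) (f := insert (v, j))).trans (hF _)
      have h4 := hsum (j + 1)
      have h5 := hsum (j - 1)
      have h6 := hF (v, j)
      rw [pow_succ]
      linarith
    · simp only [Finset.mem_union, Finset.mem_biUnion, SimpleGraph.mem_neighborFinset,
        Finset.mem_image]
      cases h with
      | down ha h => exact .inl (.inl ⟨_, ha, hmem _ _ _ h⟩)
      | up ha h => exact .inl (.inr ⟨_, ha, hmem _ _ _ h⟩)
      | collect h => exact .inr (.inl ⟨_, hmem _ _ _ h, rfl⟩)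
      | wait h => exact .inr (.inr (hmem _ _ _ h))

end Deterministic

/-! ### Tours along paths -/

section Deterministic

variable {V : Type*} {G : SimpleGraph V}

open SimpleGraph

/-- A walk can be split at an interior vertex, together with the two steps around it. -/
theorem exists_eq_append_cons_cons {a b m : V} (w : G.Walk a b) (hm : m ∈ w.support)
    (ha : m ≠ a) (hb : m ≠ b) : ∃ (x y : V) (w₁ : G.Walk a x) (hx : G.Adj x m) (hy : G.Adj m y)
      (w₂ : G.Walk y b), w = w₁.append (.cons hx (.cons hy w₂)) := by
  induction w with
  | nil => exact absurd (by simpa using hm) ha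
  | @cons a c b h w ih =>
    rcases eq_or_ne m c with rfl | hc
    · cases w with
      | nil => exact absurd rfl hb
      | cons h' w => exact ⟨_, _, .nil, h, h', w, rfl⟩
    · have hm' : m ∈ w.support := by simpa [ha] using hm
      obtain ⟨x, y, w₁, hx, hy, w₂, rfl⟩ := ih hm' hc hb
      exact ⟨x, y, .cons h w₁, hx, hy, w₂, rfl⟩

theorem exists_adj_mem_support {a b v : V} (w : G.Walk a b) (hv : v ∈ w.support) (hva : v ≠ a) :
    ∃ u ∈ w.support, G.Adj u v := by
  induction w with
  | nil => exact absurd (by simpa using hv) hva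
  | @cons a c b h w ih =>
    rcases eq_or_ne v c with rfl | hc
    · exact ⟨a, by simp, h⟩
    · obtain ⟨u, hu, hadj⟩ := ih (by simpa [hva] using hv) hc
      exact ⟨u, by simp [hu], hadj⟩

/-- The start of a path is either prolonged by one vertex of the next slice, or it is a source and
is removed. The set `R` records the removed source. -/
theorem exists_path_next_start (hG : G.IsAcyclic) {M N : ℕ → Set V} (hN : IsGenerated₂ G M N)
    {j : ℕ} {a b : V} (w : G.Walk a b) (hw : w.IsPath) (hab : a ≠ b) (haM : a ∈ M j) :
    ∃ (a' : V) (w' : G.Walk a' b) (R : Finset (V × ℕ)), w'.IsPath ∧ G.Adj a a' ∧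
      R ⊆ {(a, j)} ∧ (∀ z ∈ R, z.1 ∈ N z.2) ∧ w'.length + 2 * R.card = w.length + 1 ∧
      ∀ v ∈ w'.support, v ∈ w.support ∨ G.Adj a v ∧ v ∈ M (j + 1) := by
  cases w with
  | nil => exact absurd rfl hab
  | @cons _ c _ h w =>
    by_cases hu : ∃ u, G.Adj a u ∧ u ≠ c ∧ u ∈ M (j + 1)
    · obtain ⟨u, hau, huc, huM⟩ := hu
      refine ⟨u, .cons hau.symm (.cons h w), ∅, ?_, hau, by simp, by simp, by simp, ?_⟩
      · refine (Walk.cons_isPath_iff _ _).2 ⟨hw, fun hmem => huc ?_⟩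
        simpa using hG.eq_snd_of_adj_start hw hau hmem
      · intro v hv
        rw [Walk.support_cons, List.mem_cons] at hv
        rcases hv with rfl | hv
        · exact .inr ⟨hau, huM⟩
        · exact .inl hv
    · have haN : a ∈ N j := by
        refine (hN haM).resolve_right ?_
        rintro ⟨y, z, hyz, hy, hz, hyM, hzM⟩
        by_cases hyc : y = c
        · exact hu ⟨z, hz, fun hzc => hyz (hyc.trans hzc.symm), hzM⟩
        · exact hu ⟨y, hy, hyc, hyM⟩
      exact ⟨c, w, {(a, j)}, hw.of_cons, h, subset_rfl, by simpa using haN,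
        by simp, fun v hv => .inl (by simp [hv])⟩

variable [DecidableEq V]

/-- Let `w` be a path whose vertices of the colour of its ends lie in `M j`. Then there is a tour
between the ends of `w` at level `j` which collects sufficiently many sources, all of them
below `w`. The weights in the inequality between the length of `w`, the length of the tour and the number
of sources are such that it survives both recursion steps: cutting removes two edges of `w` and
adds two moves, but doubles the constant `4`; passing to the next level adds two moves and two edges,
except that each source which is removed costs two edges and adds one move. -/
theorem exists_tour_of_path (hG : G.IsAcyclic) {col : V → Bool}
    (hcol : ∀ ⦃u v⦄, G.Adj u v → col v = !col u) {M N : ℕ → Set V} (hM : IsClosed₂ G M)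
    (hN : IsGenerated₂ G M N) {T : ℕ} (hT : ∀ j, T ≤ j → M j = ∅) (k j : ℕ) (hk : T ≤ j + k)
    {a b : V} (w : G.Walk a b) (hw : w.IsPath) (hab : col a = col b)
    (hwM : ∀ v ∈ w.support, col v = col a → v ∈ M j) :
    ∃ l Z, Tour G (a, j) (b, j) l Z ∧ (∀ z ∈ Z, z.1 ∈ N z.2) ∧ w.length + l + 4 ≤ 5 * Z.card ∧
      ∀ z ∈ Z, ∃ v ∈ w.support, col v = col a ∧ Descends G M z.1 z.2 v j := by
  induction k generalizing j a b with
  | zero =>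
    have := hwM a w.start_mem_support rfl
    rw [hT j hk] at this
    exact this.elim
  | succ k ihk =>
  induction hn : w.length using Nat.strong_induction_on generalizing a b with
  | _ n ihn =>
  have haM := hwM a w.start_mem_support rfl
  have hbM := hwM b w.end_mem_support hab.symm
  by_cases hcut : ∃ m ∈ w.support, col m ≠ col a ∧ m ∉ M (j + 1)
  · -- the two parts of `w` on both sides of `m` have no common site below them
    obtain ⟨m, hm, hma, hmM⟩ := hcut
    obtain ⟨x, y, w₁, hx, hy, w₂, rfl⟩ := exists_eq_append_cons_cons w hm
      (fun h => hma (h ▸ rfl)) (fun h => hma (h ▸ hab.symm))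
    have hxm := hcol hx
    have hmy := hcol hy
    have hax : col a = col x := by
      revert hma hxm; cases col a <;> cases col x <;> cases col m <;> simp
    have hay : col y = col a := by rw [hmy, hxm, Bool.not_not, hax]
    have hnodup := hw.support_nodup
    rw [Walk.support_append, List.nodup_append] at hnodup
    simp only [Walk.support_cons, List.tail_cons, List.mem_cons] at hnodup
    obtain ⟨-, -, hdisj⟩ := hnodup
    have hm₁ : m ∉ w₁.support := fun h => hdisj m h m (.inl rfl) rfl
    have hm₂ : m ∉ w₂.support := ((Walk.cons_isPath_iff _ _).1 hw.of_append_right.of_cons).2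
    have hxy : x ≠ y := hdisj x w₁.end_mem_support y (.inr w₂.start_mem_support)
    simp only [Walk.length_append, Walk.length_cons] at hn
    have hs₁ : ∀ v ∈ w₁.support, v ∈ (w₁.append (.cons hx (.cons hy w₂))).support :=
      fun v hv => by simp [Walk.mem_support_append_iff, hv]
    have hs₂ : ∀ v ∈ w₂.support, v ∈ (w₁.append (.cons hx (.cons hy w₂))).support :=
      fun v hv => by simp [Walk.mem_support_append_iff, hv]
    obtain ⟨l₁, Z₁, ht₁, hZ₁, hl₁, hd₁⟩ := ihn w₁.length (by omega) w₁ hw.of_append_left hax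
      (fun v hv => hwM v (hs₁ v hv)) rfl
    obtain ⟨l₂, Z₂, ht₂, hZ₂, hl₂, hd₂⟩ := ihn w₂.length (by omega) w₂
      hw.of_append_right.of_cons.of_cons (hay.trans hab)
      (fun v hv h => hwM v (hs₂ v hv) (h.trans hay)) rfl
    have hdis : Disjoint Z₁ Z₂ := by
      refine Finset.disjoint_left.2 fun z hz₁ hz₂ => ?_
      obtain ⟨v₁, hv₁, hc₁, h₁⟩ := hd₁ z hz₁
      obtain ⟨v₂, hv₂, hc₂, h₂⟩ := hd₂ z hz₂
      generalize hp : z.1 = p at h₁ h₂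
      generalize hi : z.2 = i at h₁ h₂
      cases h₁ with
      | refl => exact hdisj _ hv₁ _ (.inr hv₂) h₂.eq_of_same_level.symm
      | @step _ q₁ _ hadj₁ hq₁ h₁ =>
        cases h₂ with
        | refl => have := h₁.le; omega
        | @step _ q₂ _ hadj₂ hq₂ h₂ =>
          have hmq : col m = col q₁ := by rw [hcol hadj₁, hc₁, hax, hxm]
          obtain ⟨u, hu⟩ := (h₁.linked hM h₂ hq₁ hq₂).exists_walk hcol hq₁ hmM hmq
          have hne₁ : m ≠ v₁ := fun h => hm₁ (h ▸ hv₁)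
          have hne₂ : m ≠ v₂ := fun h => hm₂ (h ▸ hv₂)
          have := mem_support_of_adj_adj hG hx hy hxy
            ((w₁.dropUntil v₁ hv₁).reverse.append ((Walk.cons hadj₁ (u.concat hadj₂.symm)).append
              (w₂.takeUntil v₂ hv₂).reverse))
          simp only [Walk.mem_support_append_iff, Walk.support_reverse, List.mem_reverse,
            Walk.support_cons, List.mem_cons, Walk.support_concat, List.mem_append,
            List.not_mem_nil, hne₁, hne₂, hu, false_or] at this
          rcases this with h | h
          · exact hm₁ (w₁.support_dropUntil_subset_support hv₁ h)
          · exact hm₂ (w₂.support_takeUntil_subset_support hv₂ h)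
    refine ⟨l₁ + (l₂ + 1 + 1), Z₁ ∪ Z₂, ht₁.trans (.down hx (.up hy ht₂)), ?_, ?_, ?_⟩
    · intro z hz
      exact (Finset.mem_union.1 hz).elim (hZ₁ z) (hZ₂ z)
    · rw [Finset.card_union_of_disjoint hdis]
      omega
    · intro z hz
      rcases Finset.mem_union.1 hz with hz | hz
      · obtain ⟨v, hv, hc, h⟩ := hd₁ z hz
        exact ⟨v, hs₁ v hv, hc, h⟩
      · obtain ⟨v, hv, hc, h⟩ := hd₂ z hz
        exact ⟨v, hs₂ v hv, hc.trans hay, h⟩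
  · push Not at hcut
    -- the path on the next level, between neighbours of the ends, and the removed sources
    suffices hnext : (w.length = 0 ∧ a ∈ N j) ∨ ∃ (a' b' : V) (w' : G.Walk a' b')
        (R : Finset (V × ℕ)) (R' : Finset (V × ℕ)), w'.IsPath ∧ G.Adj a a' ∧ G.Adj b' b ∧
        R ⊆ {(a, j)} ∧ R' ⊆ {(b, j)} ∧ Disjoint R R' ∧ (∀ z ∈ R ∪ R', z.1 ∈ N z.2) ∧
        w'.length + 2 * R.card + 2 * R'.card = w.length + 2 ∧
        ∀ v ∈ w'.support, (v ∈ w.support ∨ v ∈ M (j + 1)) ∧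
          (col v ≠ col a → ∃ u ∈ w.support, G.Adj u v) by
      rcases hnext with ⟨hlen, haN⟩ | ⟨a', b', w', R, R', hw', haa', hbb', hR, hR', hRR', hRN, hlen,
        hsup⟩
      · obtain rfl := w.eq_of_length_eq_zero hlen
        refine ⟨1, {(a, j)}, .collect (.nil _), by simpa using haN, by simp; omega, ?_⟩
        intro z hz
        obtain rfl := Finset.mem_singleton.1 hz
        exact ⟨a, w.start_mem_support, rfl, .refl⟩
      · have hca := hcol haa'
        have hcb : col a' = col b' := by rw [hca, hab, hcol hbb', Bool.not_not]
        have hne : ∀ v, col v = col a' → col v ≠ col a := fun v hv h => by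
          rw [hca, h] at hv; simp at hv
        have hw'M : ∀ v ∈ w'.support, col v = col a' → v ∈ M (j + 1) := fun v hv hc =>
          (hsup v hv).1.elim (fun h => hcut v h (hne v hc)) id
        obtain ⟨l, Z, ht, hZ, hl, hd⟩ := ihk (j + 1) (by omega) w' hw' hcb hw'M
        have hlev : ∀ z ∈ Z, j < z.2 := fun z hz => by
          obtain ⟨v, -, -, h⟩ := hd z hz
          exact h.le
        have hRj : ∀ z ∈ R ∪ R', z.2 = j := fun z hz => by
          rcases Finset.mem_union.1 hz with hz | hz
          · rw [Finset.mem_singleton.1 (hR hz)]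
          · rw [Finset.mem_singleton.1 (hR' hz)]
        have hdis : Disjoint (R ∪ R') Z := Finset.disjoint_left.2 fun z hz hz' => by
          have := hlev z hz'
          have := hRj z hz
          omega
        refine ⟨_, _, (Tour.of_subset_singleton hR).trans
          ((Tour.down haa' (ht.trans (Tour.up hbb' (.nil _)))).trans
            (Tour.of_subset_singleton hR')), ?_, ?_, ?_⟩
        · intro z hz
          simp only [Finset.mem_union, Finset.union_empty] at hz
          rcases hz with hz | hz | hz
          · exact hRN z (by simp [hz])
          · exact hZ z hz
          · exact hRN z (by simp [hz])
        · have : R ∪ (Z ∪ ∅ ∪ R') = (R ∪ R') ∪ Z := by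
            ext; simp only [Finset.mem_union, Finset.union_empty]; tauto
          rw [this, Finset.card_union_of_disjoint hdis, Finset.card_union_of_disjoint hRR']
          omega
        · intro z hz
          simp only [Finset.mem_union, Finset.union_empty] at hz
          rcases hz with hz | hz | hz
          · rw [Finset.mem_singleton.1 (hR hz)]
            exact ⟨a, w.start_mem_support, rfl, .refl⟩
          · obtain ⟨v, hv, hc, h⟩ := hd z hz
            obtain ⟨u, hu, huv⟩ := (hsup v hv).2 (hne v hc)
            refine ⟨u, hu, ?_, .step huv (hw'M v hv hc) h⟩
            rw [hcol huv, hca, Bool.not_inj_iff] at hc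
            exact hc
          · rw [Finset.mem_singleton.1 (hR' hz)]
            exact ⟨b, w.end_mem_support, hab.symm, .refl⟩
    cases w with
    | nil =>
      refine (hN haM).imp (fun h => ⟨rfl, h⟩) ?_
      rintro ⟨y, z, hyz, hy, hz, hyM, hzM⟩
      refine ⟨y, z, .cons hy.symm (.cons hz .nil), ∅, ∅, ?_, hy, hz.symm, by simp, by simp,
        by simp, by simp, by simp, ?_⟩
      · simp [Walk.cons_isPath_iff, hy.ne', hz.ne, hyz]
      · simp only [Walk.support_cons, Walk.support_nil, List.mem_cons, List.not_mem_nil, or_false]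
        rintro v (rfl | rfl | rfl)
        · exact ⟨.inr hyM, fun _ => ⟨_, rfl, hy⟩⟩
        · exact ⟨.inl rfl, fun h => absurd rfl h⟩
        · exact ⟨.inr hzM, fun _ => ⟨_, rfl, hz⟩⟩
    | @cons _ c _ h w =>
      right
      set w₀ := Walk.cons h w
      have hne : a ≠ b := by
        rintro rfl
        exact ((Walk.cons_isPath_iff _ _).1 hw).2 w.end_mem_support
      obtain ⟨a', w₁, R, hp₁, haa', hR, hRN, hlen₁, hsup₁⟩ :=
        exists_path_next_start hG hN w₀ hw hne haM
      have hne' : b ≠ a' := by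
        rintro rfl
        have := hcol haa'
        rw [hab] at this
        simp at this
      obtain ⟨b', w₂, R', hp₂, hbb', hR', hRN', hlen₂, hsup₂⟩ :=
        exists_path_next_start hG hN w₁.reverse hp₁.reverse hne' hbM
      rw [Walk.length_reverse] at hlen₂
      refine ⟨a', b', w₂.reverse, R, R', hp₂.reverse, haa', hbb'.symm, hR, hR', ?_, ?_, ?_, ?_⟩
      · refine Finset.disjoint_left.2 fun z hz hz' => hne ?_
        have := (Finset.mem_singleton.1 (hR hz)).symm.trans (Finset.mem_singleton.1 (hR' hz'))
        exact congrArg Prod.fst this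
      · intro z hz
        exact (Finset.mem_union.1 hz).elim (hRN z) (hRN' z)
      · rw [Walk.length_reverse]; omega
      · intro v hv
        rw [Walk.support_reverse, List.mem_reverse] at hv
        rcases hsup₂ v hv with hv | ⟨hv, hvM⟩
        · rw [Walk.support_reverse, List.mem_reverse] at hv
          rcases hsup₁ v hv with hv | ⟨hv, hvM⟩
          · exact ⟨.inl hv, fun hva => exists_adj_mem_support w₀ hv fun h => hva (h ▸ rfl)⟩
          · exact ⟨.inr hvM, fun _ => ⟨a, w₀.start_mem_support, hv⟩⟩
        · exact ⟨.inr hvM, fun _ => ⟨b, w₀.end_mem_support, hv⟩⟩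

/-- A vertex of the slice `M 0` is the starting point of a tour whose length is five times the
number of sites which it collects, all of them sources. -/
theorem exists_tour (hG : G.IsAcyclic) {M N : ℕ → Set V} (hM : IsClosed₂ G M)
    (hN : IsGenerated₂ G M N) {T : ℕ} (hT : ∀ j, T ≤ j → M j = ∅) {x : V} (hx : x ∈ M 0) :
    ∃ Z : Finset (V × ℕ), Z.Nonempty ∧ (∀ z ∈ Z, z.1 ∈ N z.2) ∧
      Tour G (x, 0) (x, 0) (5 * Z.card) Z := by
  obtain ⟨c⟩ := hG.colorable_two
  have hcol : ∀ ⦃u v⦄, G.Adj u v → decide (c v = 0) = !decide (c u = 0) := fun u v h => by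
    have h1 := c.valid h
    revert h1
    generalize c u = i
    generalize c v = k
    revert i k
    decide
  obtain ⟨l, Z, ht, hZ, hl, -⟩ := exists_tour_of_path hG hcol hM hN hT T 0 (by omega)
    (Walk.nil : G.Walk x x) .nil rfl (by simpa using hx)
  exact ⟨Z, Finset.card_pos.1 (by omega), hZ, ht.of_le (by omega)⟩

end Deterministic

open MeasureTheory ProbabilityTheory

/-! ### The threshold-two closure of a set of sites -/

section Infection

variable {V : Type*} (G : SimpleGraph V)

/-- The closure of the set of noisy sites under the rule that a vertex with two neighbours one
level below is added, for a process that starts with the empty set `k` levels further below. -/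
def infected (N : ℕ → Set V) : ℕ → ℕ → Set V
  | 0, _ => ∅
  | k + 1, j => {x | x ∈ N j ∨ ∃ y z, y ≠ z ∧ G.Adj x y ∧ G.Adj x z ∧
      y ∈ infected N k (j + 1) ∧ z ∈ infected N k (j + 1)}

theorem isClosed₂_infected (N : ℕ → Set V) (n : ℕ) :
    IsClosed₂ G fun j => infected G N (n - j) j := by
  intro j x y z hy hz hyz hyM hzM
  beta_reduce at hyM hzM ⊢
  rcases Nat.lt_or_ge j n with hj | hj
  · rw [show n - j = n - (j + 1) + 1 by omega]
    exact .inr ⟨y, z, hyz, hy, hz, hyM, hzM⟩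
  · rw [show n - (j + 1) = 0 by omega] at hyM
    exact hyM.elim

theorem isGenerated₂_infected (N : ℕ → Set V) (n : ℕ) :
    IsGenerated₂ G (fun j => infected G N (n - j) j) N := by
  intro j x hx
  beta_reduce at hx ⊢
  rcases Nat.lt_or_ge j n with hj | hj
  · rw [show n - j = n - (j + 1) + 1 by omega] at hx
    exact hx
  · rw [show n - j = 0 by omega] at hx
    exact hx.elim

end Infection

/-! ### The process started from all spins `1` in the distant past -/

section History

variable {V : Type*} (G : SimpleGraph V) [G.LocallyFinite]

theorem vote_mono {σ τ : Config V} (h : ∀ y, σ y = -1 → τ y = -1) {x : V}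
    (hx : vote G σ x = -1) : vote G τ x = -1 := by
  have hle : ∀ y, (τ y : ℤ) ≤ σ y := fun y => by
    rcases Int.units_eq_one_or (σ y) with hs | hs
    · rcases Int.units_eq_one_or (τ y) with ht | ht <;> simp [hs, ht]
    · simp [hs, h y hs]
  have hsum : ∑ y ∈ G.neighborFinset x, (τ y : ℤ) ≤ ∑ y ∈ G.neighborFinset x, (σ y : ℤ) :=
    Finset.sum_le_sum fun y _ => hle y
  unfold vote at hx
  split_ifs at hx with h2 h3
  · exact absurd hx (by decide)
  · rw [vote, if_neg (by omega), if_pos (by omega)]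
  · rw [vote]
    split_ifs with h4 h5
    · omega
    · rfl
    · exact h x hx

theorem vote_congr {σ τ : Config V} {x : V} (hx : σ x = τ x)
    (h : ∀ y, G.Adj x y → σ y = τ y) : vote G σ x = vote G τ x := by
  have hsum : ∑ y ∈ G.neighborFinset x, (σ y : ℤ) = ∑ y ∈ G.neighborFinset x, (τ y : ℤ) :=
    Finset.sum_congr rfl fun y hy => by rw [h y ((G.mem_neighborFinset x y).1 hy)]
  unfold vote
  rw [hsum, hx]

/-- With at least three neighbours, two of them have to carry the spin `-1` for the vote
to result in `-1`. -/
theorem exists_two_of_vote_eq_neg_one {σ : Config V} {x : V} (hd : 3 ≤ G.degree x)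
    (hx : vote G σ x = -1) :
    ∃ y z, y ≠ z ∧ G.Adj x y ∧ G.Adj x z ∧ σ y = -1 ∧ σ z = -1 := by
  classical
  have hsum : ∑ y ∈ G.neighborFinset x, (σ y : ℤ) ≤ 0 := by
    by_contra h
    rw [vote, if_pos (by omega)] at hx
    exact absurd hx (by decide)
  set A := (G.neighborFinset x).filter fun y => σ y = -1 with hA
  have hval : ∀ y, (σ y : ℤ) = 1 - if σ y = -1 then 2 else 0 := fun y => by
    rcases Int.units_eq_one_or (σ y) with hs | hs <;> simp [hs]
  have hcard : (G.degree x : ℤ) - 2 * A.card ≤ 0 := by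
    refine le_trans (le_of_eq ?_) hsum
    rw [Finset.sum_congr rfl fun y _ => hval y, Finset.sum_sub_distrib, ← Finset.sum_filter]
    simp [hA, mul_comm]
  obtain ⟨y, hy, z, hz, hyz⟩ := Finset.one_lt_card.1 (show 1 < A.card by omega)
  simp only [hA, Finset.mem_filter, SimpleGraph.mem_neighborFinset] at hy hz
  exact ⟨y, z, hyz, hy.1, hz.1, hy.2, hz.2⟩

/-- `history G ω k j`: the configuration `j` time steps before the present, if `k` time steps
earlier all spins were `1`. The updates use the inputs `ω`, where `ω i` is the input of the step that
leads to the configuration `i` time steps before the present. -/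
def history (ω : ℕ → V → SiteInput) : ℕ → ℕ → Config V
  | 0, _ => 1
  | k + 1, j => step G (history ω k (j + 1)) (ω j)

theorem history_shift (ω : ℕ → V → SiteInput) (k j : ℕ) :
    history G (fun i => ω (i + 1)) k j = history G ω k (j + 1) := by
  induction k generalizing j with
  | zero => rfl
  | succ k ih => simp only [history, ih]

theorem history_mono_succ (ω : ℕ → V → SiteInput) (k j : ℕ) {x : V}
    (h : history G ω k j x = -1) : history G ω (k + 1) j x = -1 := by
  induction k generalizing j x with
  | zero => exact absurd h (by simp only [history, Pi.one_apply]; decide)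
  | succ k ih =>
    rw [history, step] at h ⊢
    split_ifs at h ⊢ with hu
    · exact h
    · exact vote_mono G (fun y hy => ih (j + 1) hy) h

theorem history_mono (ω : ℕ → V → SiteInput) {k l : ℕ} (hkl : k ≤ l) (j : ℕ) {x : V}
    (h : history G ω k j x = -1) : history G ω l j x = -1 := by
  induction hkl with
  | refl => exact h
  | step _ ih => exact history_mono_succ G ω _ j ih

open Classical in
/-- The limit of `history G ω k j` as the starting time tends to the infinite past; the spins can
only decrease with `k`. -/
noncomputable def limitHistory (ω : ℕ → V → SiteInput) (j : ℕ) : Config V := fun x =>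
  if ∃ k, history G ω k j x = -1 then -1 else 1

theorem limitHistory_eq_neg_one {ω : ℕ → V → SiteInput} {j : ℕ} {x : V} :
    limitHistory G ω j x = -1 ↔ ∃ k, history G ω k j x = -1 := by
  unfold limitHistory
  split_ifs with h
  · simp [h]
  · simp [h, show (1 : ℤˣ) ≠ -1 by decide]

theorem exists_history_eq_limitHistory (ω : ℕ → V → SiteInput) (j : ℕ) (x : V) :
    ∃ k, ∀ l, k ≤ l → history G ω l j x = limitHistory G ω j x := by
  by_cases h : ∃ k, history G ω k j x = -1
  · obtain ⟨k, hk⟩ := h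
    exact ⟨k, fun l hl => by
      rw [history_mono G ω hl j hk, (limitHistory_eq_neg_one G).2 ⟨k, hk⟩]⟩
  · refine ⟨0, fun l _ => ?_⟩
    rw [limitHistory, if_neg h]
    exact (Int.units_eq_one_or _).resolve_right fun hl => h ⟨l, hl⟩

theorem limitHistory_eq_step (ω : ℕ → V → SiteInput) (j : ℕ) :
    limitHistory G ω j = step G (limitHistory G ω (j + 1)) (ω j) := by
  funext x
  choose K hK using exists_history_eq_limitHistory G ω (j + 1)
  obtain ⟨k₀, hk₀⟩ := exists_history_eq_limitHistory G ω j x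
  -- from time `k` on, the spins at `x` and at its neighbours have reached their limits
  set k := max k₀ (max (K x) ((G.neighborFinset x).sup K)) with hk
  rw [← hk₀ (k + 1) (by omega), history, step, step]
  split_ifs
  · rfl
  · refine vote_congr G (hK x k (by omega)) fun y hy => hK y k ?_
    have := Finset.le_sup (f := K) ((G.mem_neighborFinset x y).2 hy)
    omega

theorem limitHistory_shift (ω : ℕ → V → SiteInput) (j : ℕ) :
    limitHistory G (fun i => ω (i + 1)) j = limitHistory G ω (j + 1) := by
  have hneg : ∀ x, limitHistory G (fun i => ω (i + 1)) j x = -1 ↔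
      limitHistory G ω (j + 1) x = -1 := fun x => by
    simp only [limitHistory_eq_neg_one, history_shift]
  funext x
  rcases Int.units_eq_one_or (limitHistory G ω (j + 1) x) with h | h
  · rw [h]
    refine (Int.units_eq_one_or _).resolve_right fun h' => ?_
    rw [(hneg x).1 h'] at h
    exact absurd h (by decide)
  · rw [h, (hneg x).2 h]

theorem history_subset_infected (hd : ∀ x, 3 ≤ G.degree x) (ω : ℕ → V → SiteInput) (k j : ℕ)
    {x : V} (h : history G ω k j x = -1) :
    x ∈ infected G (fun j => {x | (ω j x).1 = true}) k j := by
  induction k generalizing j x with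
  | zero => exact absurd h (by simp only [history, Pi.one_apply]; decide)
  | succ k ih =>
    rw [history, step] at h
    split_ifs at h with hu
    · exact .inl hu
    · obtain ⟨y, z, hyz, hy, hz, hy', hz'⟩ := exists_two_of_vote_eq_neg_one G (hd x) h
      exact .inr ⟨y, z, hyz, hy, hz, ih _ hy', ih _ hz'⟩

/-- If the spin at `x` is `-1` now, then a tour which starts at `x` collects noisy sites only,
and their number is a fifth of its length. -/
theorem exists_tour_of_history [DecidableEq V] (hG : G.IsAcyclic) (hd : ∀ x, 3 ≤ G.degree x)
    {ω : ℕ → V → SiteInput} {k : ℕ} {x : V} (h : history G ω k 0 x = -1) :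
    ∃ Z : Finset (V × ℕ), Z.Nonempty ∧ (∀ z ∈ Z, (ω z.2 z.1).1 = true) ∧
      Tour G (x, 0) (x, 0) (5 * Z.card) Z :=
  exists_tour hG (isClosed₂_infected G _ k) (isGenerated₂_infected G _ k) (T := k)
    (fun j hj => by simp only [Nat.sub_eq_zero_of_le hj, infected])
    (history_subset_infected G hd ω k 0 h)

end History

/-! ### Probability estimates -/

instance : MeasurableSingletonClass ℤˣ where
  measurableSet_singleton s := by
    have : ({s} : Set ℤˣ) = Units.val ⁻¹' {(s : ℤ)} := by ext; simp [Units.val_inj]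
    rw [this]
    exact comap_measurable _ (measurableSet_singleton _)

section Probability

variable {V : Type*}

/-- The law of the inputs of all time steps, which are independent. -/
noncomputable def noiseLaw (V : Type*) (ε : unitInterval) : Measure (ℕ → V → SiteInput) :=
  Measure.infinitePi fun _ : ℕ => inputLaw V ε

instance (ε : unitInterval) : IsProbabilityMeasure (noiseLaw V ε) := by
  unfold noiseLaw; infer_instance

theorem siteLaw_noise (ε : unitInterval) :
    siteLaw ε {u | u.1 = true} = ENNReal.ofReal ε := by
  have : {u : SiteInput | u.1 = true} = {true} ×ˢ Set.univ := by ext; simp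
  rw [this, siteLaw, Measure.prod_prod, measure_univ, mul_one,
    bernoulliMeasure_apply_of_mem_of_notMem _ (.singleton _) rfl (by simp)]
  rw [ENNReal.ofReal, unitInterval.toNNReal, Real.toNNReal_of_nonneg ε.2.1]
  rfl

theorem noiseLaw_forall_noise [DecidableEq V] (ε : unitInterval) (Z : Finset (V × ℕ)) :
    noiseLaw V ε {ω | ∀ z ∈ Z, (ω z.2 z.1).1 = true} = ENNReal.ofReal ε ^ Z.card := by
  have hms : MeasurableSet {u : SiteInput | u.1 = true} :=
    measurable_fst (measurableSet_singleton true)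
  have hset : {ω : ℕ → V → SiteInput | ∀ z ∈ Z, (ω z.2 z.1).1 = true} =
      (MeasurableEquiv.curry ℕ V SiteInput).symm ⁻¹'
        ((Z.image Prod.swap : Finset (ℕ × V)) : Set (ℕ × V)).pi fun _ => {u | u.1 = true} := by
    ext ω
    simp only [Set.mem_ofPred_eq, Set.mem_preimage, Set.mem_pi, Finset.mem_coe, Finset.mem_image,
      forall_exists_index, and_imp]
    exact ⟨fun h p z hz hp => by subst hp; exact h z hz, fun h z hz => h _ z hz rfl⟩
  rw [hset, ← MeasurableEquiv.map_apply, noiseLaw]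
  unfold inputLaw
  rw [Measure.infinitePi_map_curry_symm (fun _ _ => siteLaw ε), Measure.infinitePi_pi _
    fun _ _ => hms]
  simp [siteLaw_noise, Finset.card_image_of_injective _ Prod.swap_injective]

theorem measurable_history (G : SimpleGraph V) [G.LocallyFinite] (k j : ℕ) :
    Measurable fun ω : ℕ → V → SiteInput => history G ω k j := by
  induction k generalizing j with
  | zero => exact measurable_const
  | succ k ih => exact (measurable_step G).comp ((ih (j + 1)).prodMk (measurable_pi_apply j))

theorem measurable_limitHistory (G : SimpleGraph V) [G.LocallyFinite] (j : ℕ) :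
    Measurable fun ω : ℕ → V → SiteInput => limitHistory G ω j := by
  refine measurable_pi_lambda _ fun x => ?_
  refine Measurable.ite ?_ measurable_const measurable_const
  have : {ω : ℕ → V → SiteInput | ∃ k, history G ω k j x = -1} =
      ⋃ k, {ω | history G ω k j x = -1} := by ext; simp
  rw [this]
  exact .iUnion fun k => (measurable_pi_apply x).comp (measurable_history G k j)
    (measurableSet_singleton (-1))

theorem noiseLaw_limitHistory_le {d : ℕ} (hd : 3 ≤ d) {ε : unitInterval}
    (hε : (ε : ℝ) < 1 / (4 * (2 * d + 2) ^ 5)) {G : SimpleGraph V} [G.LocallyFinite]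
    (hG : G.IsAcyclic) (hreg : G.IsRegularOfDegree d) (x : V) :
    noiseLaw V ε {ω | limitHistory G ω 0 x = -1} ≤ 3⁻¹ := by
  classical
  choose F hF hmem using fun n => Tour.exists_finset hreg (5 * n) (x, 0)
  have hC : (((2 * d + 2) ^ 5 : ℕ) : ENNReal) * ENNReal.ofReal ε ≤ 4⁻¹ := by
    have h4 : (2 * d + 2 : ℝ) ^ 5 * ε ≤ 4⁻¹ := by
      rw [lt_div_iff₀ (by positivity)] at hε
      linarith
    rw [← ENNReal.ofReal_natCast, ← ENNReal.ofReal_mul (by positivity),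
      show (4⁻¹ : ENNReal) = ENNReal.ofReal 4⁻¹ by
        rw [ENNReal.ofReal_inv_of_pos (by norm_num)]; simp]
    exact ENNReal.ofReal_le_ofReal (by push_cast; exact h4)
  have hsub : {ω | limitHistory G ω 0 x = -1} ⊆ ⋃ n, ⋃ Z ∈ (F (n + 1)).filter (·.card = n + 1),
      {ω | ∀ z ∈ Z, (ω z.2 z.1).1 = true} := by
    intro ω hω
    obtain ⟨k, hk⟩ := (limitHistory_eq_neg_one G).1 hω
    obtain ⟨Z, hZ, hN, ht⟩ := exists_tour_of_history G hG (fun y => (hreg y).symm ▸ hd) hk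
    obtain ⟨n, hn⟩ := Nat.exists_eq_succ_of_ne_zero hZ.card_pos.ne'
    simp only [Set.mem_iUnion]
    refine ⟨n, Z, Finset.mem_filter.2 ⟨hmem _ (x, 0) _ ?_, hn⟩, hN⟩
    rwa [← Nat.succ_eq_add_one, ← hn]
  calc noiseLaw V ε {ω | limitHistory G ω 0 x = -1}
      ≤ ∑' n, ∑ Z ∈ (F (n + 1)).filter (·.card = n + 1),
          noiseLaw V ε {ω | ∀ z ∈ Z, (ω z.2 z.1).1 = true} :=
        (measure_mono hsub).trans ((measure_iUnion_le _).trans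
          (ENNReal.tsum_le_tsum fun n => measure_biUnion_finset_le _ _))
    _ ≤ ∑' n : ℕ, (4⁻¹ : ENNReal) ^ (n + 1) := by
        refine ENNReal.tsum_le_tsum fun n => ?_
        calc ∑ Z ∈ (F (n + 1)).filter (·.card = n + 1),
              noiseLaw V ε {ω | ∀ z ∈ Z, (ω z.2 z.1).1 = true}
            = ((F (n + 1)).filter (·.card = n + 1)).card * ENNReal.ofReal ε ^ (n + 1) := by
              rw [← nsmul_eq_mul, ← Finset.sum_const]
              exact Finset.sum_congr rfl fun Z hZ => by
                rw [noiseLaw_forall_noise, (Finset.mem_filter.1 hZ).2]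
          _ ≤ (((2 * d + 2) ^ 5 : ℕ) : ENNReal) ^ (n + 1) * ENNReal.ofReal ε ^ (n + 1) := by
              gcongr
              rw [← Nat.cast_pow, ← pow_mul]
              exact_mod_cast (Finset.card_filter_le _ _).trans (hF _)
          _ ≤ 4⁻¹ ^ (n + 1) := by
              rw [← mul_pow]
              gcongr
    _ = 3⁻¹ := by
        rw [ENNReal.tsum_geometric_add_one,
          ← ENNReal.toReal_eq_toReal_iff' (ENNReal.mul_ne_top (by simp)
            (ENNReal.inv_ne_top.2 (tsub_pos_of_lt (by simp)).ne')) (by simp)]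
        rw [ENNReal.toReal_mul, ENNReal.toReal_inv, ENNReal.toReal_inv, ENNReal.toReal_inv,
          ENNReal.toReal_sub_of_le (by simp) (by simp), ENNReal.toReal_inv]
        norm_num

end Probability

/-! ### Invariance and spin flip -/

section Equilibrium

variable {V : Type*} (G : SimpleGraph V) [G.LocallyFinite]

/-- The law of the limit configuration of the process started from all spins `1`. -/
noncomputable def upperLaw (ε : unitInterval) : Measure (Config V) :=
  (noiseLaw V ε).map fun ω => limitHistory G ω 0

theorem noiseLaw_map_shift (ε : unitInterval) :
    (noiseLaw V ε).map (fun ω => ((fun i => ω (i + 1)), ω 0)) =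
      (noiseLaw V ε).prod (inputLaw V ε) := by
  classical
  set Φ : (ℕ → V → SiteInput) × (V → SiteInput) → ℕ → V → SiteInput :=
    fun p i => Nat.casesOn i p.2 p.1 with hΦdef
  have hΦ : Measurable Φ := by
    refine measurable_pi_lambda _ fun i => ?_
    cases i with
    | zero => exact measurable_snd
    | succ i => exact (measurable_pi_apply i).comp measurable_fst
  have hshift : Measurable fun ω : ℕ → V → SiteInput => ((fun i => ω (i + 1)), ω 0) := by
    fun_prop
  have hmap : ((noiseLaw V ε).prod (inputLaw V ε)).map Φ = noiseLaw V ε := by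
    refine Measure.eq_infinitePi _ fun s t ht => ?_
    have hset : Φ ⁻¹' (s : Set ℕ).pi t =
        ((s.preimage (· + 1) (add_left_injective 1).injOn : Finset ℕ) : Set ℕ).pi
          (fun i => t (i + 1)) ×ˢ (if 0 ∈ s then t 0 else Set.univ) := by
      ext ⟨ω, u⟩
      simp only [Set.mem_preimage, Set.mem_pi, Finset.mem_coe, Set.mem_prod, Finset.mem_preimage]
      constructor
      · refine fun h => ⟨fun i hi => h _ hi, ?_⟩
        split_ifs with h0
        · exact h 0 h0
        · trivial
      · rintro ⟨h, h0⟩ i hi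
        cases i with
        | zero => rw [if_pos hi] at h0; exact h0
        | succ i => exact h i hi
    rw [Measure.map_apply hΦ (.pi s.countable_toSet fun i _ => ht i), hset, Measure.prod_prod,
      noiseLaw, Measure.infinitePi_pi _ fun i _ => ht _,
      Finset.prod_preimage' (· + 1) s (add_left_injective 1).injOn
        fun i => inputLaw V ε (t i)]
    rw [← Finset.prod_filter_mul_prod_filter_not s (· ∈ Set.range (· + 1))]
    congr 1
    have hnot : s.filter (· ∉ Set.range (· + 1)) = if 0 ∈ s then {0} else ∅ := by
      ext i
      cases i with
      | zero => split_ifs with h <;> simp [h]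
      | succ i => split_ifs <;> simp
    rw [hnot]
    split_ifs <;> simp
  conv_lhs => rw [← hmap, Measure.map_map hshift hΦ]
  exact Measure.map_id

theorem transition_apply (ε : unitInterval) (σ : Config V) :
    transition G ε σ = (inputLaw V ε).map (step G σ) := rfl

theorem measurable_step_right (σ : Config V) : Measurable (step G σ) :=
  (measurable_step G).comp (measurable_const.prodMk measurable_id)

theorem isEquilibrium_upperLaw (ε : unitInterval) : IsEquilibrium G ε (upperLaw G ε) := by
  have hm := measurable_limitHistory G 0
  refine ⟨Measure.isProbabilityMeasure_map hm.aemeasurable, ?_⟩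
  have hstep : Measurable fun p : (ℕ → V → SiteInput) × (V → SiteInput) =>
      step G (limitHistory G p.1 0) p.2 :=
    (measurable_step G).comp ((hm.comp measurable_fst).prodMk measurable_snd)
  have hshift : Measurable fun ω : ℕ → V → SiteInput => ((fun i => ω (i + 1)), ω 0) := by
    fun_prop
  have hlaw : upperLaw G ε = ((noiseLaw V ε).prod (inputLaw V ε)).map
      fun p => step G (limitHistory G p.1 0) p.2 := by
    rw [← noiseLaw_map_shift, Measure.map_map hstep hshift, upperLaw]
    congr 1
    funext ω
    rw [limitHistory_eq_step, ← limitHistory_shift]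
    rfl
  rw [Kernel.Invariant]
  ext s hs
  rw [Measure.bind_apply hs (Kernel.aemeasurable _), hlaw, Measure.map_apply hstep hs,
    Measure.prod_apply (hstep hs), ← hlaw, upperLaw,
    lintegral_map (Kernel.measurable_coe _ hs) hm]
  refine lintegral_congr fun ω => ?_
  rw [transition_apply, Measure.map_apply (measurable_step_right G _) hs]
  rfl

theorem measurable_neg_config : Measurable fun σ : Config V => -σ :=
  measurable_pi_lambda _ fun x => (measurable_of_finite fun s : ℤˣ => -s).comp
    (measurable_pi_apply x)

theorem vote_neg (σ : Config V) (x : V) : vote G (-σ) x = -vote G σ x := by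
  have hsum : ∑ y ∈ G.neighborFinset x, ((-σ) y : ℤ) = -∑ y ∈ G.neighborFinset x, (σ y : ℤ) := by
    rw [← Finset.sum_neg_distrib]; rfl
  unfold vote
  rw [hsum]
  split_ifs <;> first | omega | simp

theorem step_neg (σ : Config V) (u : V → SiteInput) :
    step G (-σ) u = -step G σ fun x => ((u x).1, -(u x).2) := by
  funext x
  rw [Pi.neg_apply, step, step]
  split_ifs
  · simp
  · exact vote_neg G σ x

theorem siteLaw_map_neg (ε : unitInterval) :
    (siteLaw ε).map (fun u => (u.1, -u.2)) = siteLaw ε := by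
  have hneg : Measurable fun s : ℤˣ => -s := measurable_of_finite _
  have hunif : (PMF.uniformOfFintype ℤˣ).toMeasure.map (fun s => -s) =
      (PMF.uniformOfFintype ℤˣ).toMeasure := by
    rw [PMF.toMeasure_map (fun s : ℤˣ => -s) _ hneg]
    congr 1
    ext s
    rw [PMF.map_apply]
    refine (tsum_eq_single (-s) fun t ht => if_neg fun h : s = -t =>
      ht (by rw [h, neg_neg])).trans ?_
    simp
  have := Measure.map_prod_map (bernoulliMeasure true false ε)
    (PMF.uniformOfFintype ℤˣ).toMeasure measurable_id hneg
  rw [hunif, Measure.map_id] at this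
  exact this.symm

theorem inputLaw_map_neg (ε : unitInterval) :
    (inputLaw V ε).map (fun u x => ((u x).1, -(u x).2)) = inputLaw V ε := by
  unfold inputLaw
  rw [Measure.infinitePi_map_pi (f := fun _ (u : SiteInput) => (u.1, -u.2)) _
    fun _ => measurable_of_finite _]
  simp_rw [siteLaw_map_neg]

theorem transition_neg (ε : unitInterval) (σ : Config V) :
    transition G ε (-σ) = (transition G ε σ).map fun τ => -τ := by
  rw [transition_apply, transition_apply, Measure.map_map measurable_neg_config
    (measurable_step_right G σ)]
  have hflip : Measurable fun (u : V → SiteInput) x => ((u x).1, -(u x).2) :=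
    measurable_pi_lambda _ fun x => (measurable_of_finite fun u : SiteInput => (u.1, -u.2)).comp
      (measurable_pi_apply x)
  conv_rhs => rw [← inputLaw_map_neg, Measure.map_map
    (measurable_neg_config.comp (measurable_step_right G σ)) hflip]
  congr 1
  funext u
  exact step_neg G σ u

theorem IsEquilibrium.map_neg {ε : unitInterval} {μ : Measure (Config V)}
    (h : IsEquilibrium G ε μ) : IsEquilibrium G ε (μ.map fun σ => -σ) := by
  obtain ⟨hμ, hinv⟩ := h
  refine ⟨Measure.isProbabilityMeasure_map measurable_neg_config.aemeasurable, ?_⟩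
  rw [Kernel.Invariant]
  ext s hs
  have hs' := measurable_neg_config hs
  rw [Measure.bind_apply hs (Kernel.aemeasurable _), lintegral_map (Kernel.measurable_coe _ hs)
    measurable_neg_config, Measure.map_apply measurable_neg_config hs]
  conv_rhs => rw [← hinv.def, Measure.bind_apply hs' (Kernel.aemeasurable _)]
  refine lintegral_congr fun σ => ?_
  rw [transition_neg, Measure.map_apply measurable_neg_config hs]

end Equilibrium
end NoisyMajority

theorem theorem1p1 (d : ℕ) (hd : 3 ≤ d) :
    ∃ ε₀ : ℝ, 0 < ε₀ ∧ ∀ ε : unitInterval, 0 < (ε : ℝ) → (ε : ℝ) < ε₀ →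
      ∀ (V : Type*) (G : SimpleGraph V) [G.LocallyFinite],
        G.IsTree → G.IsRegularOfDegree d →
          ∃ μ ν : MeasureTheory.Measure (NoisyMajority.Config V),
            NoisyMajority.IsEquilibrium G ε μ ∧ NoisyMajority.IsEquilibrium G ε ν ∧ μ ≠ ν := by
  refine ⟨1 / (4 * (2 * d + 2) ^ 5), by positivity, fun ε _ hε V G _ hG hreg => ?_⟩
  have heq := NoisyMajority.isEquilibrium_upperLaw G ε
  refine ⟨_, _, heq, heq.map_neg, fun h => ?_⟩
  have := heq.1
  obtain ⟨x⟩ := hG.connected.nonempty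
  have hms : ∀ s : ℤˣ, MeasurableSet {σ : NoisyMajority.Config V | σ x = s} := fun s =>
    (measurable_pi_apply (X := fun _ : V => ℤˣ) x) (MeasurableSet.singleton s)
  have hle : NoisyMajority.upperLaw G ε {σ | σ x = -1} ≤ 3⁻¹ := by
    rw [NoisyMajority.upperLaw, MeasureTheory.Measure.map_apply
      (NoisyMajority.measurable_limitHistory G 0) (hms _)]
    exact NoisyMajority.noiseLaw_limitHistory_le hd hε hG.isAcyclic hreg x
  -- by symmetry both spins at `x` would have the same probability
  have hsymm : NoisyMajority.upperLaw G ε {σ | σ x = 1} ≤ 3⁻¹ := by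
    refine le_trans (le_of_eq ?_) hle
    conv_rhs => rw [h, MeasureTheory.Measure.map_apply NoisyMajority.measurable_neg_config (hms _)]
    congr 1
    ext σ
    simp
  have huniv : (1 : ENNReal) ≤ 3⁻¹ + 3⁻¹ := by
    rw [← MeasureTheory.measure_univ (μ := NoisyMajority.upperLaw G ε)]
    refine (MeasureTheory.measure_mono fun σ _ => ?_).trans
      ((MeasureTheory.measure_union_le _ _).trans (add_le_add hsymm hle))
    exact Int.units_eq_one_or (σ x)
  have hlt : (3⁻¹ + 3⁻¹ : ENNReal) < 1 := by
    rw [← ENNReal.toReal_lt_toReal (by finiteness) (by finiteness),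
      ENNReal.toReal_add (by finiteness) (by finiteness), ENNReal.toReal_inv]
    norm_num
  exact huniv.not_gt hlt
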